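/- Let $\ell_1$ be the real Banach space of absolutely summable real sequences with its usual norm, and let $M\subseteq\ell_1$ be an infinite subset, equipped with the metric inherited from $\ell_1$ and with an arbitrary fixed base point $0_M\in M$. Let $\mathrm{Lip}_0(M)$ be the Banach space of all Lipschitz functions $f\colon M\to\mathbb{R}$ with $f(0_M)=0$, with the norm $$\|f\|=\sup\Big\{\frac{|f(x)-f(y)|}{\|x-y\|_1}\colon x,y\in M,\ x\neq y\Big\}.$$ Then $\mathrm{Lip}_0(M)$ has the symmetric strong diameter $2$ property. That is, writing $X=\mathrm{Lip}_0(M)$ and $B_X$ for its closed unit ball, and calling a set a slice of $B_X$ if it has the form $\{x\in B_X\colon x^*(x)>1-\alpha\}$ with $x^*\in X^*$, $\|x^*\|=1$ and $\alpha>0$: for every $n\in\mathbb{N}$, all slices $S_1,\dots,S_n$ of $B_X$ and every $\varepsilon>0$, there exist $f_1\in S_1,\dots,f_n\in S_n$ and $g\in B_X$ with $\|g\|>1-\varepsilon$ such that $f_i+g\in S_i$ and $f_i-g\in S_i$ for every $i\in\{1,\dots,n\}$. -/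

import Mathlib

/-- The vector space of all Lipschitz functions `f : M → ℝ` with `f o = 0`, as a subspace of
`M → ℝ`. -/
def lipZeroSubmodule (M : Type*) [MetricSpace M] (o : M) : Submodule ℝ (M → ℝ) where
  carrier := {f | (∃ K : NNReal, LipschitzWith K f) ∧ f o = 0}
  zero_mem' := ⟨⟨0, LipschitzWith.const 0⟩, rfl⟩
  add_mem' := by
    rintro f g ⟨⟨K, hK⟩, hf⟩ ⟨⟨L, hL⟩, hg⟩
    exact ⟨⟨K + L, hK.add hL⟩, by simp [hf, hg]⟩
  smul_mem' := by
    rintro c f ⟨⟨K, hK⟩, hf⟩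
    refine ⟨⟨‖c‖₊ * K, LipschitzWith.of_dist_le_mul fun x y => ?_⟩, by simp [hf]⟩
    have h := hK.dist_le_mul x y
    rw [Real.dist_eq] at h ⊢
    simp only [Pi.smul_apply, smul_eq_mul, ← mul_sub, abs_mul, NNReal.coe_mul, coe_nnnorm,
      Real.norm_eq_abs, mul_assoc]
    exact mul_le_mul_of_nonneg_left h (abs_nonneg c)

/-- The space `Lip₀(M)` over the metric space `M` with base point `o`. It is a type synonym of
`lipZeroSubmodule M o`, so that it carries the Lipschitz norm and its topology rather than the
topology of pointwise convergence. -/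
def LipZero (M : Type*) [MetricSpace M] (o : M) : Type _ := lipZeroSubmodule M o

namespace LipZero

variable {M : Type*} [MetricSpace M] {o : M}

instance : AddCommGroup (LipZero M o) := inferInstanceAs (AddCommGroup (lipZeroSubmodule M o))

instance : Module ℝ (LipZero M o) := inferInstanceAs (Module ℝ (lipZeroSubmodule M o))

instance : CoeFun (LipZero M o) (fun _ => M → ℝ) := ⟨fun f => f.1⟩

/-- The Lipschitz norm `‖f‖ = sup {|f x - f y| / d(x, y) : x ≠ y}`. -/
noncomputable instance : Norm (LipZero M o) where
  norm f := sSup {r : ℝ | ∃ x y : M, x ≠ y ∧ r = |f x - f y| / dist x y}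

theorem norm_def (f : LipZero M o) :
    ‖f‖ = sSup {r : ℝ | ∃ x y : M, x ≠ y ∧ r = |f x - f y| / dist x y} := rfl

theorem bddAbove_slopes (f : LipZero M o) :
    BddAbove {r : ℝ | ∃ x y : M, x ≠ y ∧ r = |f x - f y| / dist x y} := by
  obtain ⟨⟨K, hK⟩, -⟩ := f.2
  refine ⟨K, ?_⟩
  rintro r ⟨x, y, hxy, rfl⟩
  rw [div_le_iff₀ (dist_pos.2 hxy), ← Real.dist_eq]
  exact hK.dist_le_mul x y

theorem norm_nonneg' (f : LipZero M o) : 0 ≤ ‖f‖ := by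
  refine Real.sSup_nonneg ?_
  rintro r ⟨x, y, -, rfl⟩
  positivity

theorem abs_sub_le (f : LipZero M o) (x y : M) : |f x - f y| ≤ ‖f‖ * dist x y := by
  by_cases hxy : x = y
  · simp [hxy]
  · rw [← div_le_iff₀ (dist_pos.2 hxy)]
    exact le_csSup (bddAbove_slopes f) ⟨x, y, hxy, rfl⟩

theorem norm_le_of_abs_sub_le (f : LipZero M o) {C : ℝ} (hC : 0 ≤ C)
    (h : ∀ x y : M, |f x - f y| ≤ C * dist x y) : ‖f‖ ≤ C := by
  refine Real.sSup_le ?_ hC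
  rintro r ⟨x, y, hxy, rfl⟩
  rw [div_le_iff₀ (dist_pos.2 hxy)]
  exact h x y

theorem apply_base (f : LipZero M o) : f o = 0 := f.2.2

theorem add_apply (f g : LipZero M o) (x : M) : (f + g) x = f x + g x := rfl

theorem neg_apply (f : LipZero M o) (x : M) : (-f) x = -f x := rfl

theorem zero_apply (x : M) : (0 : LipZero M o) x = 0 := rfl

theorem smul_apply (c : ℝ) (f : LipZero M o) (x : M) : (c • f) x = c * f x := rfl

noncomputable instance : NormedAddCommGroup (LipZero M o) :=
  AddGroupNorm.toNormedAddCommGroup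
    { toFun := fun f => ‖f‖
      map_zero' := le_antisymm
        (norm_le_of_abs_sub_le _ le_rfl fun x y => by simp [zero_apply]) (norm_nonneg' _)
      add_le' := fun f g => by
        refine norm_le_of_abs_sub_le _ (add_nonneg (norm_nonneg' f) (norm_nonneg' g)) ?_
        intro x y
        rw [add_apply, add_apply, add_sub_add_comm, add_mul]
        exact (abs_add_le _ _).trans (add_le_add (abs_sub_le f x y) (abs_sub_le g x y))
      neg' := fun f => by
        simp only [norm_def, neg_apply, neg_sub_neg, abs_sub_comm]
      eq_zero_of_map_eq_zero' := fun f hf => by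
        refine Subtype.ext (funext fun x => ?_)
        have h := abs_sub_le f x o
        have hf' : ‖f‖ = 0 := hf
        rw [hf', zero_mul, apply_base, sub_zero] at h
        exact abs_nonpos_iff.1 h }

noncomputable instance : NormedSpace ℝ (LipZero M o) where
  norm_smul_le c f := by
    refine norm_le_of_abs_sub_le _ (mul_nonneg (norm_nonneg c) (norm_nonneg' f)) ?_
    intro x y
    rw [smul_apply, smul_apply, ← mul_sub, abs_mul, Real.norm_eq_abs, mul_assoc]
    exact mul_le_mul_of_nonneg_left (abs_sub_le f x y) (abs_nonneg c)

end LipZero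

/-- A slice of the closed unit ball of `X`: a set of the form
`{x ∈ B_X : φ x > 1 - α}` with `φ` in the unit sphere of the dual space and `α > 0`. -/
def IsUnitBallSlice {X : Type*} [NormedAddCommGroup X] [NormedSpace ℝ X] (S : Set X) : Prop :=
  ∃ (φ : StrongDual ℝ X) (α : ℝ), ‖φ‖ = 1 ∧ 0 < α ∧ S = {x : X | ‖x‖ ≤ 1 ∧ 1 - α < φ x}

/-- The symmetric strong diameter `2` property. -/
def HasSSD2P (X : Type*) [NormedAddCommGroup X] [NormedSpace ℝ X] : Prop :=
  ∀ (n : ℕ) (S : Fin n → Set X), (∀ i, IsUnitBallSlice (S i)) → ∀ ε : ℝ, 0 < ε →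
    ∃ (f : Fin n → X) (g : X), (∀ i, f i ∈ S i) ∧ ‖g‖ ≤ 1 ∧ 1 - ε < ‖g‖ ∧
      ∀ i, f i + g ∈ S i ∧ f i - g ∈ S i

/-!
The proof produces, for given `1`-Lipschitz functions `f` and `ε > 0`, a sequence of modifications
`h k` of `f` and functions `g k` (independent of `f`) such that `‖h k ± g k‖ ≤ 1 + ε`,
`‖g k‖ ≥ 1 - ε`, and `h k → f`, `g k → 0` weakly in `Lip₀(M)`. Taking `f` in the slices, a late
index and a scaling by `(1 + ε)⁻¹` give the symmetric strong diameter two property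
(`hasSSD2P_of_hasFlatPerturbations`). Weak convergence to zero of a sequence `u k` needs no
knowledge of the dual space: it suffices that `∑ k, |u k x - u k y| ≤ C * dist x y` with a uniform
`C` (`LipZero.tendsto_apply_zero_of_sum_abs_sub_le`). All functions live on `ℓ₁`, the elements of
`Lip₀(M)` being extended there.

If `M` is unbounded or not uniformly discrete, the argument works in any complete metric space.
There are pairwise disjoint annuli of arbitrarily large ratio of radii, with a point of `M` at the
middle radius and another one inside: concentric ones if `M` is unbounded or has an accumulation
point, and otherwise around the members of close pairs which are far from each other
(`exists_accumulation_or_separated_close_pairs`). In each annulus, `f` is made constant around the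
middle radius by a cutoff that is slow on the logarithmic scale, which costs a factor close to `1`
in the Lipschitz constant, and `g` is a tent function of the radius placed where `f` has been made
constant (`hasFlatPerturbations_of_hasDisjointAnnuli`). Disjointness of the supports gives the
domination.

If `M` is bounded and uniformly discrete, being infinite it contains pairs whose differences are
almost carried by pairwise disjoint finite blocks `N k` of coordinates
(`exists_pairs_with_disjoint_blocks`). Then `h k` is `f` composed with the map erasing the
coordinates in `N k`, and `g k` is a norm one functional depending only on these coordinates; as
`‖u‖` is the sum of the norms of the two parts, `h k ± g k` is again `1`-Lipschitz
(`hasFlatPerturbations_of_isBounded_of_discrete`).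
-/

open Filter Topology

/-! ### Weakly null sequences of Lipschitz functions -/

namespace LipZero

variable {M : Type*} [MetricSpace M] {o : M}

theorem sum_smul_apply {ι : Type*} (s : Finset ι) (a : ι → ℝ) (u : ι → LipZero M o) (x : M) :
    (∑ k ∈ s, a k • u k : LipZero M o) x = ∑ k ∈ s, a k * u k x := by
  classical
  induction s using Finset.induction_on with
  | empty => simp [zero_apply]
  | insert i s hi ih => rw [Finset.sum_insert hi, Finset.sum_insert hi, add_apply, ih, smul_apply]

/-- The element `x ↦ F x - F o` of `Lip₀(M)` given by a Lipschitz function `F`. -/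
def ofLipschitz (o : M) (F : M → ℝ) {C : ℝ} (h : ∀ x y, |F x - F y| ≤ C * dist x y) :
    LipZero M o :=
  ⟨fun x => F x - F o, ⟨C.toNNReal, LipschitzWith.of_dist_le_mul fun x y => by
    rw [Real.dist_eq, sub_sub_sub_cancel_right]
    exact (h x y).trans (mul_le_mul_of_nonneg_right (Real.le_coe_toNNReal C) dist_nonneg)⟩,
    sub_self _⟩

theorem ofLipschitz_apply (F : M → ℝ) {C : ℝ} (h : ∀ x y, |F x - F y| ≤ C * dist x y) (x : M) :
    ofLipschitz o F h x = F x - F o := rfl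

theorem sub_apply (f g : LipZero M o) (x : M) : (f - g) x = f x - g x := rfl

/-- If the partial sums `∑ |u k x - u k y|` are uniformly dominated by the distance, then
all signed partial sums of `u` are uniformly bounded, so `∑ |φ (u k)|` converges for every
functional `φ`, and `u` is weakly null. -/
theorem tendsto_apply_zero_of_sum_abs_sub_le {u : ℕ → LipZero M o} {C : ℝ} (hC : 0 ≤ C)
    (hu : ∀ (s : Finset ℕ) (x y : M), ∑ k ∈ s, |u k x - u k y| ≤ C * dist x y)
    (φ : StrongDual ℝ (LipZero M o)) : Tendsto (fun k => φ (u k)) atTop (𝓝 0) := by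
  have hs : Summable fun k => |φ (u k)| := by
    refine summable_of_sum_le (c := ‖φ‖ * C) (fun k => abs_nonneg _) fun s => ?_
    set a : ℕ → ℝ := fun k => SignType.sign (φ (u k)) with ha
    have ha1 : ∀ k, |a k| ≤ 1 := fun k => by
      rcases lt_trichotomy (φ (u k)) 0 with h | h | h <;> simp [ha, h]
    have h1 : ∑ k ∈ s, |φ (u k)| = φ (∑ k ∈ s, a k • u k) := by
      rw [map_sum]
      refine Finset.sum_congr rfl fun k _ => ?_
      rw [map_smul, smul_eq_mul, ha, sign_mul_self]
    have h2 : ‖∑ k ∈ s, a k • u k‖ ≤ C := by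
      refine norm_le_of_abs_sub_le _ hC fun x y => ?_
      rw [sum_smul_apply, sum_smul_apply, ← Finset.sum_sub_distrib]
      refine (Finset.abs_sum_le_sum_abs _ _).trans (le_trans ?_ (hu s x y))
      refine Finset.sum_le_sum fun k _ => ?_
      rw [← mul_sub, abs_mul]
      exact mul_le_of_le_one_left (abs_nonneg _) (ha1 k)
    rw [h1]
    exact (le_abs_self _).trans ((φ.le_opNorm _).trans
      (mul_le_mul_of_nonneg_left h2 (norm_nonneg φ)))
  exact (tendsto_zero_iff_abs_tendsto_zero _).2 hs.tendsto_atTop_zero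

end LipZero

/-- For a subset `M` of a metric space `E`: there are functions `g k` of slope almost `1` on some
pair of points of `M` and ways `F ↦ T k F` to modify `1`-Lipschitz functions, such that
`T k F ± g k` is almost `1`-Lipschitz on `M`, and such that `g k` and `F - T k F` satisfy the
domination that makes them weakly null in `Lip₀(M)`. -/
def HasFlatPerturbations {E : Type*} [MetricSpace E] (M : Set E) (ε : ℝ) : Prop :=
  ∃ (C : ℝ) (g : ℕ → E → ℝ) (T : ℕ → (E → ℝ) → E → ℝ), 0 ≤ C ∧
    (∀ k, ∃ x ∈ M, ∃ y ∈ M, x ≠ y ∧ (1 - ε) * dist x y ≤ |g k x - g k y|) ∧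
    (∀ s : Finset ℕ, ∀ x ∈ M, ∀ y ∈ M, ∑ k ∈ s, |g k x - g k y| ≤ C * dist x y) ∧
    ∀ F : E → ℝ, LipschitzWith 1 F →
      (∀ k, ∀ x ∈ M, ∀ y ∈ M,
        |T k F x - T k F y| + |g k x - g k y| ≤ (1 + ε) * dist x y) ∧
      ∀ s : Finset ℕ, ∀ x ∈ M, ∀ y ∈ M,
        ∑ k ∈ s, |(F x - T k F x) - (F y - T k F y)| ≤ C * dist x y

theorem LipZero.exists_lipschitzWith_extension {E : Type*} [MetricSpace E] {M : Set E} {o : M}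
    {f : LipZero M o} (hf : ‖f‖ ≤ 1) : ∃ F : E → ℝ, LipschitzWith 1 F ∧ ∀ x : M, F x = f x := by
  have h : LipschitzOnWith 1 (Function.extend Subtype.val f.1 0) M := by
    refine LipschitzOnWith.of_dist_le_mul fun x hx y hy => ?_
    have hval : ∀ z : M, Function.extend Subtype.val f.1 0 (z : E) = f z :=
      fun z => Subtype.val_injective.extend_apply _ _ z
    rw [hval ⟨x, hx⟩, hval ⟨y, hy⟩, Real.dist_eq]
    exact (f.abs_sub_le _ _).trans (mul_le_mul_of_nonneg_right hf dist_nonneg)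
  obtain ⟨F, hF, hEq⟩ := h.extend_real
  exact ⟨F, hF, fun x => by
    rw [← hEq x.2]; exact Subtype.val_injective.extend_apply _ _ x⟩

theorem exists_norm_le_one_lt_apply {X : Type*} [NormedAddCommGroup X] [NormedSpace ℝ X]
    {φ : StrongDual ℝ X} {r : ℝ} (hr : r < ‖φ‖) : ∃ x, ‖x‖ ≤ 1 ∧ r < φ x := by
  obtain ⟨x, hx, hrx⟩ := φ.exists_lt_apply_of_lt_opNorm hr
  rcases le_total 0 (φ x) with h | h
  · exact ⟨x, hx.le, by rwa [Real.norm_of_nonneg h] at hrx⟩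
  · exact ⟨-x, (norm_neg x).trans_le hx.le, by rwa [map_neg, ← Real.norm_of_nonpos h]⟩

/-- A weak approximation criterion for the symmetric strong diameter two property: elements of
the slices are replaced by `T k F`, for a late index `k`, and everything is scaled by
`(1 + ε)⁻¹`. -/
theorem hasSSD2P_of_hasFlatPerturbations {E : Type*} [MetricSpace E] {M : Set E}
    (H : ∀ ε > 0, HasFlatPerturbations M ε) (o : M) : HasSSD2P (LipZero M o) := by
  intro n S hS ε₀ hε₀
  choose φ α hφ hα hSeq using hS
  have hf : ∀ i, ∃ f : LipZero M o, ‖f‖ ≤ 1 ∧ 1 - α i < φ i f := fun i =>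
    exists_norm_le_one_lt_apply (by rw [hφ i]; linarith [hα i])
  choose f hf1 hfα using hf
  obtain ⟨ε, hε, hεS, hεg⟩ : ∃ ε > 0, (∀ i, (1 + ε) * (1 - α i) < φ i (f i)) ∧
      (1 + ε) * (1 - ε₀) < 1 - ε := by
    have h1 : ∀ i, ∀ᶠ ε : ℝ in 𝓝[>] 0, (1 + ε) * (1 - α i) < φ i (f i) := fun i => by
      have : ContinuousAt (fun ε : ℝ => (1 + ε) * (1 - α i)) 0 := by fun_prop
      exact (this.eventually_lt_const (by simpa using hfα i)).filter_mono nhdsWithin_le_nhds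
    have h2 : ∀ᶠ ε : ℝ in 𝓝[>] 0, (1 + ε) * (1 - ε₀) < 1 - ε := by
      have ha : ContinuousAt (fun ε : ℝ => (1 + ε) * (1 - ε₀)) 0 := by fun_prop
      have hb : ContinuousAt (fun ε : ℝ => 1 - ε) 0 := by fun_prop
      exact (ha.eventually_lt hb (by simpa using hε₀)).filter_mono nhdsWithin_le_nhds
    obtain ⟨ε, ⟨h1', h2'⟩, hε⟩ :=
      (((eventually_all.2 h1).and h2).and self_mem_nhdsWithin).exists
    exact ⟨ε, hε, h1', h2'⟩
  obtain ⟨C, g, T, hC, hslope, hgsum, hT⟩ := H ε hε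
  choose F hF hFf using fun i => LipZero.exists_lipschitzWith_extension (hf1 i)
  -- The bound on `g` alone is read off from the joint bound for `F = 0`, as there may be no slice.
  have hgC : ∀ k, ∀ x y : M, |g k x - g k y| ≤ (1 + ε) * dist x y := fun k x y =>
    le_trans (le_add_of_nonneg_left (abs_nonneg _))
      ((hT (fun _ => 0) (LipschitzWith.const' 0)).1 k x x.2 y y.2)
  have hhC : ∀ i k, ∀ x y : M, |T k (F i) x - T k (F i) y| ≤ (1 + ε) * dist x y :=
    fun i k x y => le_trans (le_add_of_nonneg_right (abs_nonneg _))
      ((hT (F i) (hF i)).1 k x x.2 y y.2)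
  set G : ℕ → LipZero M o := fun k => LipZero.ofLipschitz o (fun x => g k x) (hgC k) with hG
  set h : ℕ → Fin n → LipZero M o :=
    fun k i => LipZero.ofLipschitz o (fun x => T k (F i) x) (hhC i k) with hh
  have hε1 : 0 ≤ 1 + ε := by linarith
  have hGnorm : ∀ k, ‖G k‖ ≤ 1 + ε := fun k => by
    refine LipZero.norm_le_of_abs_sub_le _ hε1 fun x y => ?_
    simpa [hG, LipZero.ofLipschitz_apply] using hgC k x y
  have hadd : ∀ k i, ‖h k i + G k‖ ≤ 1 + ε := fun k i => by
    refine LipZero.norm_le_of_abs_sub_le _ hε1 fun x y => ?_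
    have := (hT (F i) (hF i)).1 k x x.2 y y.2
    simp only [hh, hG, LipZero.add_apply, LipZero.ofLipschitz_apply]
    refine le_trans (le_of_eq_of_le ?_ (abs_add_le _ _)) this
    congr 1; ring
  have hsub : ∀ k i, ‖h k i - G k‖ ≤ 1 + ε := fun k i => by
    refine LipZero.norm_le_of_abs_sub_le _ hε1 fun x y => ?_
    have := (hT (F i) (hF i)).1 k x x.2 y y.2
    simp only [hh, hG, LipZero.sub_apply, LipZero.ofLipschitz_apply]
    refine le_trans (le_of_eq_of_le ?_ (abs_sub _ _)) this
    congr 1; ring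
  have hGlim : ∀ i, Tendsto (fun k => φ i (G k)) atTop (𝓝 0) := fun i =>
    LipZero.tendsto_apply_zero_of_sum_abs_sub_le hC (fun s x y => by
      simpa [hG, LipZero.ofLipschitz_apply, ← Subtype.dist_eq] using hgsum s x x.2 y y.2) (φ i)
  have hhlim : ∀ i, Tendsto (fun k => φ i (h k i)) atTop (𝓝 (φ i (f i))) := fun i => by
    have := LipZero.tendsto_apply_zero_of_sum_abs_sub_le (u := fun k => f i - h k i) hC
      (fun s x y => by
        refine le_trans (le_of_eq (Finset.sum_congr rfl fun k _ => ?_))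
          ((hT (F i) (hF i)).2 s x x.2 y y.2)
        simp only [hh, LipZero.sub_apply, LipZero.ofLipschitz_apply, hFf]
        congr 1; ring) (φ i)
    simpa using (tendsto_const_nhds (x := φ i (f i))).sub this
  obtain ⟨k, hk⟩ : ∃ k, ∀ i, (1 + ε) * (1 - α i) < φ i (h k i + G k) ∧
      (1 + ε) * (1 - α i) < φ i (h k i - G k) := by
    refine (eventually_all.2 fun i => ?_).exists (f := atTop)
    have hp := (hhlim i).add (hGlim i)
    have hm := (hhlim i).sub (hGlim i)
    simp only [add_zero, sub_zero, ← map_add, ← map_sub] at hp hm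
    exact (hp.eventually_const_lt (hεS i)).and (hm.eventually_const_lt (hεS i))
  have hpos : 0 < 1 + ε := by linarith
  have hscale : ∀ i (w : LipZero M o), ‖w‖ ≤ 1 + ε → (1 + ε) * (1 - α i) < φ i w →
      (1 + ε)⁻¹ • w ∈ S i := fun i w hw hφw => by
    rw [hSeq i]
    refine ⟨?_, ?_⟩
    · rw [norm_smul, Real.norm_of_nonneg (inv_nonneg.2 hε1), inv_mul_le_iff₀ hpos, mul_one]
      exact hw
    · rw [map_smul, smul_eq_mul, lt_inv_mul_iff₀ hpos]
      exact hφw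
  refine ⟨fun i => (1 + ε)⁻¹ • h k i, (1 + ε)⁻¹ • G k, fun i => ?_, ?_, ?_, fun i => ⟨?_, ?_⟩⟩
  · refine hscale i _ ?_ ?_
    · have h2 : (2 : ℝ) • h k i = (h k i + G k) + (h k i - G k) := by rw [two_smul]; abel
      have h3 := congrArg norm h2
      rw [norm_smul, Real.norm_ofNat] at h3
      linarith [norm_add_le (h k i + G k) (h k i - G k), hadd k i, hsub k i]
    · have := hk i
      rw [map_add, map_sub] at this
      linarith
  · rw [norm_smul, Real.norm_of_nonneg (inv_nonneg.2 hε1), inv_mul_le_iff₀ hpos, mul_one]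
    exact hGnorm k
  · rw [norm_smul, Real.norm_of_nonneg (inv_nonneg.2 hε1), lt_inv_mul_iff₀ hpos]
    refine hεg.trans_le ?_
    obtain ⟨x, hx, y, hy, hxy, hle⟩ := hslope k
    have h1 := (G k).abs_sub_le ⟨x, hx⟩ ⟨y, hy⟩
    simp only [hG, LipZero.ofLipschitz_apply, sub_sub_sub_cancel_right] at h1
    exact le_of_mul_le_mul_right (hle.trans h1) (dist_pos.2 hxy)
  · rw [← smul_add]; exact hscale i _ (hadd k i) (hk i).1
  · rw [← smul_sub]; exact hscale i _ (hsub k i) (hk i).2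

/-! ### Flat perturbations supported in disjoint annuli -/

/-- Uniformly Lipschitz functions with pairwise disjoint supports satisfy the domination
that forces weak convergence to zero: at most two terms of the sum do not vanish. -/
theorem sum_abs_sub_le_of_pairwise_disjoint {E : Type*} [MetricSpace E] {u : ℕ → E → ℝ}
    {A : ℕ → Set E} {C : ℝ} (hu : ∀ k x y, |u k x - u k y| ≤ C * dist x y)
    (hA : Pairwise (Function.onFun Disjoint A)) (hsupp : ∀ k, ∀ x ∉ A k, u k x = 0)
    (s : Finset ℕ) (x y : E) : ∑ k ∈ s, |u k x - u k y| ≤ 2 * C * dist x y := by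
  classical
  have h0 : 0 ≤ C * dist x y := (abs_nonneg _).trans (hu 0 x y)
  have hone : ∀ z : E, ∑ k ∈ s, (if z ∈ A k then C * dist x y else 0) ≤ C * dist x y := by
    intro z
    rw [← Finset.sum_filter, Finset.sum_const, nsmul_eq_mul]
    refine mul_le_of_le_one_left h0 ?_
    have : (s.filter fun k => z ∈ A k).card ≤ 1 := by
      refine Finset.card_le_one.2 fun a ha b hb => ?_
      by_contra hab
      exact Set.disjoint_left.1 (hA hab) (Finset.mem_filter.1 ha).2 (Finset.mem_filter.1 hb).2
    exact_mod_cast this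
  calc ∑ k ∈ s, |u k x - u k y|
      ≤ ∑ k ∈ s, ((if x ∈ A k then C * dist x y else 0) +
          (if y ∈ A k then C * dist x y else 0)) := by
        refine Finset.sum_le_sum fun k _ => ?_
        by_cases hx : x ∈ A k
        · rw [if_pos hx]
          refine (hu k x y).trans (le_add_of_nonneg_right ?_)
          split_ifs <;> simp [h0]
        · by_cases hy : y ∈ A k
          · rw [if_neg hx, if_pos hy, zero_add]
            exact hu k x y
          · simp [hx, hy, hsupp k x hx, hsupp k y hy]
    _ ≤ 2 * C * dist x y := by
        rw [Finset.sum_add_distrib]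
        linarith [hone x, hone y]

/-- A slowly varying cutoff in the logarithm of the radius: it vanishes for
`e⁻ᴸ t ≤ r ≤ eᴸ t` and equals `1` when `r ≤ e⁻²ᴸ t` or `r ≥ e²ᴸ t`, except that it vanishes at
`r = 0`, where `Real.log` has the value `0`. -/
noncomputable def logCutoff (L t r : ℝ) : ℝ := max 0 (min 1 (|Real.log (r / t)| / L - 1))

theorem logCutoff_nonneg (L t r : ℝ) : 0 ≤ logCutoff L t r := le_max_left _ _

theorem logCutoff_le_one (L t r : ℝ) : logCutoff L t r ≤ 1 :=
  max_le zero_le_one (min_le_left _ _)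

theorem logCutoff_zero_right (L t : ℝ) : logCutoff L t 0 = 0 := by
  simp [logCutoff]

theorem abs_logCutoff_sub_mul_le {L t a b : ℝ} (hL : 0 < L) (ht : 0 < t) (ha : 0 < a)
    (hab : a ≤ b) : |logCutoff L t b - logCutoff L t a| * a ≤ (b - a) / L := by
  have hb : 0 < b := ha.trans_le hab
  have h1 : |logCutoff L t b - logCutoff L t a| ≤
      |(|Real.log (b / t)| / L - 1) - (|Real.log (a / t)| / L - 1)| := by
    rw [logCutoff, logCutoff, max_comm, max_comm 0]
    exact (abs_max_sub_max_le_abs _ _ 0).trans ((abs_min_sub_min_le_max 1 _ 1 _).trans (by simp))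
  have h2 : |(|Real.log (b / t)| / L - 1) - (|Real.log (a / t)| / L - 1)| ≤ (b / a - 1) / L := by
    rw [sub_sub_sub_cancel_right, ← sub_div, abs_div, abs_of_pos hL]
    refine div_le_div_of_nonneg_right ?_ hL.le
    refine (abs_abs_sub_abs_le _ _).trans ?_
    have h3 : Real.log (b / t) - Real.log (a / t) = Real.log (b / a) := by
      rw [Real.log_div hb.ne' ht.ne', Real.log_div ha.ne' ht.ne', Real.log_div hb.ne' ha.ne']
      ring
    rw [h3, abs_of_nonneg (Real.log_nonneg ((one_le_div ha).2 hab))]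
    exact Real.log_le_sub_one_of_pos (div_pos hb ha)
  calc _ ≤ (b / a - 1) / L * a := mul_le_mul_of_nonneg_right (h1.trans h2) ha.le
    _ = (b - a) / L := by field_simp

/-- The cutoff is positive only far away from the radius `t` on the logarithmic scale. -/
theorem lt_or_lt_of_logCutoff_pos {L t r : ℝ} (hL : 0 < L) (ht : 0 < t) (hr : 0 ≤ r)
    (h : 0 < logCutoff L t r) : r < Real.exp (-L) * t ∨ Real.exp L * t < r := by
  rcases hr.eq_or_lt with rfl | hr
  · simp [logCutoff_zero_right] at h
  have h1 : 0 < |Real.log (r / t)| / L - 1 :=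
    (lt_min_iff.1 ((lt_max_iff.1 h).resolve_left (lt_irrefl _))).2
  rw [sub_pos, one_lt_div hL, lt_abs] at h1
  rcases h1 with h1 | h1
  · right
    rwa [Real.lt_log_iff_exp_lt (div_pos hr ht), lt_div_iff₀ ht] at h1
  · left
    rw [lt_neg, Real.log_lt_iff_lt_exp (div_pos hr ht), div_lt_iff₀ ht] at h1
    exact h1

/-- The cutoff is less than `1` only in a bounded range on the logarithmic scale. -/
theorem lt_and_lt_of_logCutoff_ne_one {L t r : ℝ} (hL : 0 < L) (ht : 0 < t) (hr : 0 < r)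
    (h : logCutoff L t r ≠ 1) : t < Real.exp (2 * L) * r ∧ r < Real.exp (2 * L) * t := by
  have h1 : |Real.log (r / t)| < 2 * L := by
    by_contra! h1
    refine h ?_
    have : 1 ≤ |Real.log (r / t)| / L - 1 := by
      rw [le_sub_iff_add_le, le_div_iff₀ hL]; linarith
    rw [logCutoff, min_eq_left this, max_eq_right zero_le_one]
  obtain ⟨h2, h3⟩ := abs_lt.1 h1
  rw [Real.log_lt_iff_lt_exp (div_pos hr ht), div_lt_iff₀ ht] at h3
  rw [Real.lt_log_iff_exp_lt (div_pos hr ht), lt_div_iff₀ ht, Real.exp_neg,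
    inv_mul_lt_iff₀ (Real.exp_pos _)] at h2
  exact ⟨h2, h3⟩

/-- A tent of slopes `1` and `-1` supported in `[a, 2 * t]`. -/
def tent (a t r : ℝ) : ℝ := max 0 (min (r - a) (2 * t - r))

theorem abs_tent_sub_le (a t r r' : ℝ) : |tent a t r - tent a t r'| ≤ |r - r'| := by
  have h : |tent a t r - tent a t r'| ≤ |min (r - a) (2 * t - r) - min (r' - a) (2 * t - r')| := by
    rw [tent, tent, max_comm, max_comm 0]
    exact abs_max_sub_max_le_abs _ _ 0
  refine h.trans ((abs_min_sub_min_le_max _ _ _ _).trans (max_le ?_ ?_))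
  · simp
  · rw [sub_sub_sub_cancel_left, abs_sub_comm]

theorem tent_nonneg (a t r : ℝ) : 0 ≤ tent a t r := le_max_left _ _

theorem tent_eq_zero_of_le {a t r : ℝ} (h : r ≤ a) : tent a t r = 0 :=
  max_eq_left ((min_le_left _ _).trans (sub_nonpos.2 h))

theorem tent_eq_zero_of_ge {a t r : ℝ} (h : 2 * t ≤ r) : tent a t r = 0 :=
  max_eq_left ((min_le_right _ _).trans (sub_nonpos.2 h))

theorem tent_le {a t r : ℝ} (ha : 0 ≤ a) (ht : 0 ≤ t) : tent a t r ≤ t := by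
  refine max_le ht ?_
  rcases le_total r t with h | h
  · exact (min_le_left _ _).trans (by linarith)
  · exact (min_le_right _ _).trans (by linarith)

theorem tent_self {a t : ℝ} (ha : 0 ≤ a) (hat : a ≤ t) : tent a t t = t - a := by
  rw [tent, min_eq_left (by linarith), max_eq_right (by linarith)]

/-- The modification of `F` which is constant on a large annulus of centre `p` around the radius
`t`, and equal to `F` outside a larger annulus. -/
noncomputable def flatten {E : Type*} [MetricSpace E] (L t : ℝ) (p : E) (F : E → ℝ) (u : E) : ℝ :=
  F p + logCutoff L t (dist u p) * (F u - F p)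

theorem abs_flatten_sub_add_abs_tent_sub_le {E : Type*} [MetricSpace E] {L t : ℝ} (hL : 2 ≤ L)
    (ht : 0 < t) (p : E) {F : E → ℝ} (hF : LipschitzWith 1 F) (x y : E) :
    |flatten L t p F x - flatten L t p F y| +
      |tent (Real.exp (-L) * t) t (dist x p) - tent (Real.exp (-L) * t) t (dist y p)| ≤
        (1 + 2 / L) * dist x y := by
  have hF' : ∀ u v, |F u - F v| ≤ dist u v := fun u v => by
    simpa [Real.dist_eq] using hF.dist_le_mul u v
  wlog hxy : dist y p ≤ dist x p generalizing x y
  · rw [abs_sub_comm, abs_sub_comm (tent _ _ _), dist_comm x y]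
    exact this y x (le_of_not_ge hxy)
  have hL0 : 0 < L := by linarith
  set l := logCutoff L t (dist x p) with hl
  have hl0 : 0 ≤ l := logCutoff_nonneg _ _ _
  have hl1 : l ≤ 1 := logCutoff_le_one _ _ _
  have hrad : dist x p - dist y p ≤ dist x y := by linarith [dist_triangle x y p]
  -- The larger radius carries the cutoff; the change of the cutoff is weighted by the smaller one.
  have h1 : |flatten L t p F x - flatten L t p F y| ≤ l * dist x y + dist x y / L := by
    have e : flatten L t p F x - flatten L t p F y =
        l * (F x - F y) + (l - logCutoff L t (dist y p)) * (F y - F p) := by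
      rw [flatten, flatten, ← hl]; ring
    rw [e]
    refine (abs_add_le _ _).trans (add_le_add ?_ ?_)
    · rw [abs_mul, abs_of_nonneg hl0]
      exact mul_le_mul_of_nonneg_left (hF' x y) hl0
    · rw [abs_mul]
      refine (mul_le_mul_of_nonneg_left (hF' y p) (abs_nonneg _)).trans ?_
      rcases (dist_nonneg (x := y) (y := p)).eq_or_lt with h | h
      · rw [← h, mul_zero]; positivity
      · exact (abs_logCutoff_sub_mul_le hL0 ht h hxy).trans (by gcongr)
  have ht1 := abs_tent_sub_le (Real.exp (-L) * t) t (dist x p) (dist y p)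
  rw [abs_of_nonneg (sub_nonneg.2 hxy)] at ht1
  have hdL : (1 + 2 / L) * dist x y = dist x y + dist x y / L + dist x y / L := by ring
  have hdL0 : 0 ≤ dist x y / L := by positivity
  rcases hl0.eq_or_lt with hl0' | hl0'
  · rw [← hl0', zero_mul, zero_add] at h1
    linarith
  have hld : l * dist x y ≤ dist x y := mul_le_of_le_one_left dist_nonneg hl1
  suffices hs : |tent (Real.exp (-L) * t) t (dist x p) - tent (Real.exp (-L) * t) t (dist y p)| ≤
      dist x y / L by linarith
  rcases lt_or_lt_of_logCutoff_pos hL0 ht dist_nonneg hl0' with h | h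
  · rw [tent_eq_zero_of_le h.le, tent_eq_zero_of_le (hxy.trans h.le)]
    simpa using hdL0
  have hexp : L + 2 ≤ Real.exp L := by
    nlinarith [Real.quadratic_le_exp_of_nonneg hL0.le]
  have h2 : (L + 2) * t ≤ dist x p := (mul_le_mul_of_nonneg_right hexp ht.le).trans h.le
  rw [tent_eq_zero_of_ge (r := dist x p) (by nlinarith), zero_sub, abs_neg,
    abs_of_nonneg (tent_nonneg _ _ _)]
  rcases le_total (2 * t) (dist y p) with h3 | h3
  · rw [tent_eq_zero_of_ge h3]; exact hdL0
  · rw [le_div_iff₀ hL0]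
    have := tent_le (r := dist y p) (mul_nonneg (Real.exp_nonneg (-L)) ht.le) ht.le
    nlinarith

/-- The open annulus of centre `p` between the radii `t / K` and `K * t`. -/
def annulus {E : Type*} [MetricSpace E] (K : ℝ) (p : E) (t : ℝ) : Set E :=
  {u | t < K * dist u p ∧ dist u p < K * t}

theorem flatten_of_notMem_annulus {E : Type*} [MetricSpace E] {L t : ℝ} (hL : 0 < L)
    (ht : 0 < t) {p : E} (F : E → ℝ) {u : E} (hu : u ∉ annulus (Real.exp (2 * L)) p t) :
    F u - flatten L t p F u = 0 := by
  rcases eq_or_ne u p with rfl | hup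
  · simp [flatten]
  · by_cases h : logCutoff L t (dist u p) = 1
    · simp [flatten, h]
    · exact absurd (lt_and_lt_of_logCutoff_ne_one hL ht (dist_pos.2 hup) h) hu

theorem tent_of_notMem_annulus {E : Type*} [MetricSpace E] {L t : ℝ} (hL : 2 ≤ L)
    (ht : 0 < t) {p u : E} (hu : u ∉ annulus (Real.exp (2 * L)) p t) :
    tent (Real.exp (-L) * t) t (dist u p) = 0 := by
  have hexp : L + 1 ≤ Real.exp L := Real.add_one_le_exp L
  have hexp2 : Real.exp L ≤ Real.exp (2 * L) := Real.exp_le_exp.2 (by linarith)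
  by_contra h
  refine hu ⟨?_, ?_⟩
  · by_contra! h1
    refine h (tent_eq_zero_of_le ?_)
    rw [Real.exp_neg, le_inv_mul_iff₀ (Real.exp_pos L)]
    exact (mul_le_mul_of_nonneg_right hexp2 dist_nonneg).trans h1
  · by_contra! h1
    exact h (tent_eq_zero_of_ge (le_trans (by nlinarith) h1))

/-- There are infinitely many pairwise disjoint annuli, of ratio `K ^ 2`, each with a point
`y k` of `M` at the middle radius and a point `q k` of `M` inside the inner circle. -/
def HasDisjointAnnuli {E : Type*} [MetricSpace E] (M : Set E) (K : ℝ) : Prop :=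
  ∃ p y q : ℕ → E,
    (∀ k, y k ∈ M ∧ q k ∈ M ∧ 0 < dist (y k) (p k) ∧
      K * dist (q k) (p k) ≤ dist (y k) (p k)) ∧
    Pairwise (Function.onFun Disjoint fun k => annulus K (p k) (dist (y k) (p k)))

theorem hasFlatPerturbations_of_hasDisjointAnnuli {E : Type*} [MetricSpace E] {M : Set E}
    (H : ∀ K > 1, HasDisjointAnnuli M K) {ε : ℝ} (hε : 0 < ε) : HasFlatPerturbations M ε := by
  set L := max 2 (2 / ε) with hLdef
  have hL2 : 2 ≤ L := le_max_left _ _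
  have hL0 : 0 < L := by linarith
  have hLε : 2 / L ≤ ε := by
    rw [div_le_iff₀ hL0, ← div_le_iff₀' hε]; exact le_max_right _ _
  obtain ⟨p, y, q, hpyq, hdisj⟩ := H (Real.exp (2 * L)) (Real.one_lt_exp_iff.2 (by linarith))
  set t : ℕ → ℝ := fun k => dist (y k) (p k) with ht
  have ht0 : ∀ k, 0 < t k := fun k => (hpyq k).2.2.1
  set g : ℕ → E → ℝ := fun k u => tent (Real.exp (-L) * t k) (t k) (dist u (p k)) with hg
  have hmain : ∀ F : E → ℝ, LipschitzWith 1 F → ∀ k x y,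
      |flatten L (t k) (p k) F x - flatten L (t k) (p k) F y| + |g k x - g k y| ≤
        (1 + ε) * dist x y := fun F hF k x y =>
    (abs_flatten_sub_add_abs_tent_sub_le hL2 (ht0 k) (p k) hF x y).trans (by gcongr)
  refine ⟨2 * (2 + ε), g, fun k => flatten L (t k) (p k), by linarith, fun k => ?_,
    fun s x _ y _ => ?_, fun F hF => ⟨fun k x _ y _ => hmain F hF k x y, fun s x _ y _ => ?_⟩⟩
  · obtain ⟨hyM, hqM, htk, hq⟩ := hpyq k
    have hexp : Real.exp (-L) ≤ ε / 2 := by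
      have h1 : (Real.exp L)⁻¹ ≤ L⁻¹ := inv_anti₀ hL0 (by linarith [Real.add_one_le_exp L])
      rw [Real.exp_neg]
      refine h1.trans ?_
      rw [div_eq_mul_inv] at hLε
      linarith
    have hexp1 : Real.exp (-L) ≤ 1 := Real.exp_le_one_iff.2 (by linarith)
    have hq' : dist (q k) (p k) ≤ Real.exp (-L) * t k := by
      rw [Real.exp_neg, le_inv_mul_iff₀ (Real.exp_pos L)]
      exact (mul_le_mul_of_nonneg_right (Real.exp_le_exp.2 (by linarith)) dist_nonneg).trans hq
    have he0 := Real.exp_pos (-L)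
    have hexplt : Real.exp (-L) < 1 := Real.exp_lt_one_iff.2 (by linarith)
    refine ⟨y k, hyM, q k, hqM, fun h => ?_, ?_⟩
    · rw [← h] at hq'
      change t k ≤ _ at hq'
      nlinarith [ht0 k]
    · have hd : dist (y k) (q k) ≤ t k + Real.exp (-L) * t k :=
        (dist_triangle_right _ _ (p k)).trans (add_le_add le_rfl hq')
      have h1 : g k (y k) = t k - Real.exp (-L) * t k :=
        tent_self (by positivity) (mul_le_of_le_one_left (ht0 k).le hexp1)
      have h2 : g k (q k) = 0 := tent_eq_zero_of_le hq'
      rw [h1, h2, sub_zero, abs_of_nonneg (by nlinarith [ht0 k])]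
      rcases le_total ε 1 with hε1 | hε1
      · refine (mul_le_mul_of_nonneg_left hd (by linarith)).trans ?_
        have : 0 ≤ t k * (ε - 2 * Real.exp (-L)) := mul_nonneg (ht0 k).le (by linarith)
        have : 0 ≤ ε * (Real.exp (-L) * t k) := by have := ht0 k; positivity
        linarith
      · refine le_trans (mul_nonpos_of_nonpos_of_nonneg (by linarith) dist_nonneg) ?_
        nlinarith [ht0 k]
  · refine sum_abs_sub_le_of_pairwise_disjoint (fun k x y => ?_) hdisj
      (fun k u hu => tent_of_notMem_annulus hL2 (ht0 k) hu) s x y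
    have h1 := hmain (fun _ => 0) (LipschitzWith.const' 0) k x y
    have h2 := abs_nonneg (flatten L (t k) (p k) (fun _ => 0) x -
      flatten L (t k) (p k) (fun _ => 0) y)
    linarith [dist_nonneg (x := x) (y := y)]
  · refine sum_abs_sub_le_of_pairwise_disjoint
      (u := fun k u => F u - flatten L (t k) (p k) F u) (fun k x y => ?_) hdisj
      (fun k u hu => flatten_of_notMem_annulus hL0 (ht0 k) F hu) s x y
    have h1 := hmain F hF k x y
    have h2 : |F x - F y| ≤ dist x y := by simpa [Real.dist_eq] using hF.dist_le_mul x y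
    have h3 := abs_sub (F x - F y) (flatten L (t k) (p k) F x - flatten L (t k) (p k) F y)
    rw [sub_sub_sub_comm]
    linarith [abs_nonneg (g k x - g k y)]

/-! ### Existence of disjoint annuli -/

theorem disjoint_annulus_of_sq_mul_le {E : Type*} [MetricSpace E] {K : ℝ} (hK : 0 < K) (p : E)
    {t t' : ℝ} (h : K ^ 2 * t ≤ t') : Disjoint (annulus K p t) (annulus K p t') := by
  refine Set.disjoint_left.2 fun u hu hu' => ?_
  have := mul_lt_mul_of_pos_left hu.2 hK
  linarith [hu'.1]

theorem hasDisjointAnnuli_of_not_isBounded {E : Type*} [MetricSpace E] {M : Set E}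
    (hM : ¬ Bornology.IsBounded M) {K : ℝ} (hK : 1 < K) : HasDisjointAnnuli M K := by
  have hK0 : 0 < K := by linarith
  obtain ⟨p, hp⟩ : M.Nonempty := by
    by_contra h
    exact hM (Set.not_nonempty_iff_eq_empty.1 h ▸ Bornology.isBounded_empty)
  have hfar : ∀ R : ℝ, ∃ y ∈ M, R < dist y p := fun R => by
    by_contra! h
    exact hM ((Metric.isBounded_iff_subset_closedBall p).2 ⟨R, h⟩)
  obtain ⟨y, hy, hr⟩ := exists_seq_of_forall_finset_exists
    (fun y => y ∈ M ∧ 0 < dist y p) (fun x y => K ^ 2 * dist x p ≤ dist y p) fun s _ => by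
      obtain ⟨y, hyM, hy⟩ := hfar (∑ x ∈ s, K ^ 2 * dist x p)
      have h0 : ∀ x ∈ s, 0 ≤ K ^ 2 * dist x p := fun x _ => by positivity
      exact ⟨y, ⟨hyM, (Finset.sum_nonneg h0).trans_lt hy⟩,
        fun x hx => (Finset.single_le_sum h0 hx).trans hy.le⟩
  refine ⟨fun _ => p, y, fun _ => p, fun k => ⟨(hy k).1, hp, (hy k).2, by simp⟩, ?_⟩
  refine (pairwise_disjoint_on _).2 fun m n hmn => ?_
  exact disjoint_annulus_of_sq_mul_le hK0 p (hr m n hmn)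

theorem hasDisjointAnnuli_of_accumulation {E : Type*} [MetricSpace E] {M : Set E} {p : E}
    (hp : ∀ r > 0, ∃ y ∈ M, 0 < dist y p ∧ dist y p < r) {K : ℝ} (hK : 1 < K) :
    HasDisjointAnnuli M K := by
  have hK0 : 0 < K := by linarith
  obtain ⟨y, hy, hr⟩ := exists_seq_of_forall_finset_exists
    (fun y => y ∈ M ∧ 0 < dist y p) (fun x y => K ^ 2 * dist y p ≤ dist x p) fun s hs => by
      have h1 : ∀ᶠ r : ℝ in 𝓝[>] 0, ∀ x ∈ s, K ^ 2 * r ≤ dist x p := by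
        refine (eventually_all_finset s).2 fun x hx => ?_
        have hc : ContinuousAt (fun r : ℝ => K ^ 2 * r) 0 := by fun_prop
        have := (hc.eventually_lt_const (by simpa only [mul_zero] using (hs x hx).2)).filter_mono
          (nhdsWithin_le_nhds (s := Set.Ioi 0))
        exact this.mono fun r hr => hr.le
      obtain ⟨r, hr, hr0⟩ := (h1.and self_mem_nhdsWithin).exists
      obtain ⟨y, hyM, hy0, hyr⟩ := hp r hr0
      refine ⟨y, ⟨hyM, hy0⟩, fun x hx => le_trans ?_ (hr x hx)⟩
      exact mul_le_mul_of_nonneg_left hyr.le (by positivity)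
  choose q hqM _ hq using fun k => hp (dist (y k) p / K) (div_pos (hy k).2 hK0)
  refine ⟨fun _ => p, y, q, fun k => ⟨(hy k).1, hqM k, (hy k).2, ?_⟩, ?_⟩
  · exact ((lt_div_iff₀' hK0).1 (hq k)).le
  · refine (pairwise_disjoint_on _).2 fun m n hmn => ?_
    exact (disjoint_annulus_of_sq_mul_le hK0 p (hr m n hmn)).symm

/-- If `M` contains arbitrarily close pairs and has no accumulation point in the complete space
`E`, then close pairs can be found at a definite distance from any finite set: otherwise the
first coordinates of the close pairs would form a filter that is totally bounded, and a finer
ultrafilter would converge to an accumulation point. -/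
theorem exists_accumulation_or_separated_close_pairs {E : Type*} [MetricSpace E]
    [CompleteSpace E] {M : Set E}
    (hM : ∀ δ > 0, ∃ x ∈ M, ∃ y ∈ M, 0 < dist x y ∧ dist x y < δ) :
    (∃ p : E, ∀ r > 0, ∃ y ∈ M, 0 < dist y p ∧ dist y p < r) ∨
    ∃ η > 0, ∀ (s : Finset E) (κ : ℝ), 0 < κ → ∃ x ∈ M, ∃ y ∈ M, 0 < dist x y ∧ dist x y < κ ∧
      ∀ z ∈ s, η ≤ dist x z := by
  refine or_iff_not_imp_right.2 fun hsep => ?_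
  push Not at hsep
  set A : ℝ → Set E := fun κ => {x ∈ M | ∃ y ∈ M, 0 < dist x y ∧ dist x y < κ} with hA
  have hne : (uniformity E ⊓ 𝓟 M.offDiag).NeBot := by
    refine inf_principal_neBot_iff.2 fun V hV => ?_
    obtain ⟨δ, hδ, hδV⟩ := Metric.mem_uniformity_dist.1 hV
    obtain ⟨x, hx, y, hy, h0, hlt⟩ := hM δ hδ
    exact ⟨(x, y), hδV hlt, hx, hy, dist_pos.1 h0⟩
  set U : Ultrafilter E := Ultrafilter.of (map Prod.fst (uniformity E ⊓ 𝓟 M.offDiag)) with hU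
  have hAU : ∀ κ > 0, A κ ∈ U := fun κ hκ => by
    refine Ultrafilter.of_le _ (mem_map.2 ?_)
    filter_upwards [mem_inf_of_left (Metric.dist_mem_uniformity hκ),
      mem_inf_of_right (mem_principal_self M.offDiag)] with z hz hzM
    exact ⟨hzM.1, z.2, hzM.2.1, dist_pos.2 hzM.2.2, hz⟩
  have hcauchy : Cauchy (U : Filter E) := by
    refine Metric.cauchy_iff.2 ⟨inferInstance, fun ε hε => ?_⟩
    obtain ⟨s, κ, hκ, hs⟩ := hsep (ε / 2) (half_pos hε)
    have hcover : (⋃ z ∈ (s : Set E), Metric.ball z (ε / 2)) ∈ U := by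
      refine mem_of_superset (hAU κ hκ) fun x ⟨hx, y, hy, h0, hlt⟩ => ?_
      obtain ⟨z, hz, hxz⟩ := hs x hx y hy h0 hlt
      exact Set.mem_biUnion hz hxz
    obtain ⟨z, -, hz⟩ := (Ultrafilter.finite_biUnion_mem_iff s.finite_toSet).1 hcover
    refine ⟨_, hz, fun x hx y hy => ?_⟩
    have := dist_triangle_right x y z
    linarith [Metric.mem_ball.1 hx, Metric.mem_ball.1 hy]
  obtain ⟨p, hp⟩ := CompleteSpace.complete hcauchy
  refine ⟨p, fun r hr => ?_⟩
  obtain ⟨x, hxp, hx, y, hy, h0, hlt⟩ :=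
    U.nonempty_of_mem (inter_mem (hp (Metric.ball_mem_nhds p (half_pos hr)))
      (hAU (r / 2) (half_pos hr)))
  rw [Metric.mem_ball] at hxp
  rcases eq_or_ne x p with rfl | hne
  · exact ⟨y, hy, by rwa [dist_comm], by rw [dist_comm]; linarith⟩
  · exact ⟨x, hx, dist_pos.2 hne, by linarith⟩

theorem hasDisjointAnnuli_of_separated_close_pairs {E : Type*} [MetricSpace E] {M : Set E} {η : ℝ}
    (hη : 0 < η) (H : ∀ (s : Finset E) (κ : ℝ), 0 < κ → ∃ x ∈ M, ∃ y ∈ M, 0 < dist x y ∧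
      dist x y < κ ∧ ∀ z ∈ s, η ≤ dist x z) {K : ℝ} (hK : 1 < K) : HasDisjointAnnuli M K := by
  classical
  have hK0 : 0 < K := by linarith
  obtain ⟨w, hw, hr⟩ := exists_seq_of_forall_finset_exists
    (fun w : E × E => w.1 ∈ M ∧ w.2 ∈ M ∧ 0 < dist w.2 w.1 ∧ K * dist w.2 w.1 < η / 2)
    (fun v w => η ≤ dist w.1 v.1) fun s _ => by
      obtain ⟨x, hx, y, hy, h0, hlt, hs⟩ := H (s.image Prod.fst) (η / 2 / K) (by positivity)
      rw [dist_comm, lt_div_iff₀' hK0] at hlt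
      exact ⟨(x, y), ⟨hx, hy, by rwa [dist_comm], hlt⟩,
        fun v hv => hs _ (Finset.mem_image_of_mem _ hv)⟩
  -- Both the centre and the inner point of each annulus are the first point of the pair.
  refine ⟨fun k => (w k).1, fun k => (w k).2, fun k => (w k).1, fun k =>
    ⟨(hw k).2.1, (hw k).1, (hw k).2.2.1, by simp⟩, ?_⟩
  refine (pairwise_disjoint_on _).2 fun m n hmn => ?_
  refine Set.disjoint_left.2 fun u hu hu' => ?_
  have := dist_triangle_left (w n).1 (w m).1 u
  linarith [hr m n hmn, hu.2, hu'.2, (hw m).2.2.2, (hw n).2.2.2]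

/-! ### Bounded uniformly discrete subsets of `ℓ₁` -/

/-- The sequence `u` with the coordinates in `N` replaced by `0`. -/
noncomputable def eraseCoords (N : Finset ℕ) (u : lp (fun _ : ℕ => ℝ) 1) :
    lp (fun _ : ℕ => ℝ) 1 :=
  u - ∑ i ∈ N, lp.single 1 i (u i)

theorem norm_eraseCoords (N : Finset ℕ) (u : lp (fun _ : ℕ => ℝ) 1) :
    ‖eraseCoords N u‖ = ‖u‖ - ∑ i ∈ N, |u i| := by
  simpa [eraseCoords] using lp.norm_compl_sum_single (p := 1) (by simp) u N

theorem norm_sub_eraseCoords (N : Finset ℕ) (u : lp (fun _ : ℕ => ℝ) 1) :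
    ‖u - eraseCoords N u‖ = ∑ i ∈ N, |u i| := by
  simpa [eraseCoords] using lp.norm_sum_single (p := 1) (E := fun _ : ℕ => ℝ) (by simp) u N

theorem eraseCoords_sub (N : Finset ℕ) (u v : lp (fun _ : ℕ => ℝ) 1) :
    eraseCoords N (u - v) = eraseCoords N u - eraseCoords N v := by
  simp only [eraseCoords, lp.coeFn_sub, Pi.sub_apply, lp.single_sub, Finset.sum_sub_distrib]
  abel

theorem sum_abs_le_norm (N : Finset ℕ) (u : lp (fun _ : ℕ => ℝ) 1) : ∑ i ∈ N, |u i| ≤ ‖u‖ := by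
  linarith [norm_eraseCoords N u, norm_nonneg (eraseCoords N u)]

theorem sum_sum_abs_le_norm {N : ℕ → Finset ℕ}
    (hN : Pairwise (Function.onFun Disjoint N)) (s : Finset ℕ) (u : lp (fun _ : ℕ => ℝ) 1) :
    ∑ k ∈ s, ∑ i ∈ N k, |u i| ≤ ‖u‖ := by
  classical
  rw [← Finset.sum_biUnion fun a _ b _ hab => hN hab]
  exact sum_abs_le_norm _ u

theorem exists_finset_lt_sum_abs (u : lp (fun _ : ℕ => ℝ) 1) {c : ℝ} (hc : c < ‖u‖) :
    ∃ N : Finset ℕ, c < ∑ i ∈ N, |u i| := by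
  have h : HasSum (fun i => |u i|) ‖u‖ := by
    simpa using lp.hasSum_norm (p := 1) (by simp) u
  exact (h.eventually_const_lt hc).exists

/-- Finitely many coordinates do not separate the points of an infinite bounded set by a definite
amount, since bounded sets in finite dimension are totally bounded. -/
theorem exists_ne_sum_abs_sub_lt {M : Set (lp (fun _ : ℕ => ℝ) 1)} (hM : M.Infinite)
    (hbdd : Bornology.IsBounded M) (N : Finset ℕ) {c : ℝ} (hc : 0 < c) :
    ∃ x ∈ M, ∃ y ∈ M, x ≠ y ∧ ∑ i ∈ N, |(x - y) i| < c := by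
  obtain ⟨R, hR⟩ := hbdd.exists_norm_le
  set ρ : lp (fun _ : ℕ => ℝ) 1 → (N → ℝ) := fun u i => u i with hρ
  set c' := c / (2 * (N.card + 1)) with hc'
  have hc'0 : 0 < c' := by positivity
  have hmem : ∀ x ∈ M, ρ x ∈ Metric.closedBall (0 : N → ℝ) R := fun x hx => by
    rw [mem_closedBall_zero_iff, pi_norm_le_iff_of_nonneg ((norm_nonneg x).trans (hR x hx))]
    exact fun i => (lp.norm_apply_le_norm one_ne_zero x i).trans (hR x hx)
  obtain ⟨s, hs, hcover⟩ := Metric.totallyBounded_iff.1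
    (isCompact_closedBall (0 : N → ℝ) R).totallyBounded c' hc'0
  have hex : ∀ x ∈ M, ∃ z ∈ s, dist (ρ x) z < c' := fun x hx => by
    simpa using hcover (hmem x hx)
  choose! z hzs hz using hex
  obtain ⟨x, hx, y, hy, hne, hxy⟩ := hM.exists_ne_map_eq_of_mapsTo hzs hs
  refine ⟨x, hx, y, hy, hne, ?_⟩
  have hd : dist (ρ x) (ρ y) ≤ 2 * c' := by
    have := dist_triangle_right (ρ x) (ρ y) (z x)
    have h2 := hz y hy
    rw [← hxy] at h2
    linarith [hz x hx]
  have hle : ∑ i ∈ N, |(x - y) i| ≤ N.card * (2 * c') := by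
    rw [← nsmul_eq_mul]
    refine Finset.sum_le_card_nsmul _ _ _ fun i hi => ?_
    have := (dist_le_pi_dist (ρ x) (ρ y) ⟨i, hi⟩).trans hd
    simpa [hρ, Real.dist_eq] using this
  refine hle.trans_lt ?_
  have : (N.card : ℝ) * (2 * c') = c * (N.card / (N.card + 1)) := by rw [hc']; field_simp
  rw [this]
  refine mul_lt_of_lt_one_right hc ?_
  rw [div_lt_one (by positivity)]
  linarith

/-- Pairs of points whose differences are almost supported in pairwise disjoint finite blocks. -/
theorem exists_pairs_with_disjoint_blocks {M : Set (lp (fun _ : ℕ => ℝ) 1)} (hM : M.Infinite)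
    (hbdd : Bornology.IsBounded M) {δ : ℝ} (hδ : 0 < δ)
    (hdisc : ∀ x ∈ M, ∀ y ∈ M, x ≠ y → δ ≤ dist x y) {ε : ℝ} (hε : 0 < ε) :
    ∃ (x y : ℕ → lp (fun _ : ℕ => ℝ) 1) (N : ℕ → Finset ℕ),
      (∀ k, x k ∈ M ∧ y k ∈ M ∧ x k ≠ y k ∧
        (1 - ε) * dist (x k) (y k) ≤ ∑ i ∈ N k, |(x k - y k) i|) ∧
      Pairwise (Function.onFun Disjoint N) := by
  classical
  obtain ⟨w, hw, hr⟩ := exists_seq_of_forall_finset_exists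
    (fun w : (lp (fun _ : ℕ => ℝ) 1 × lp (fun _ : ℕ => ℝ) 1) × Finset ℕ =>
      w.1.1 ∈ M ∧ w.1.2 ∈ M ∧ w.1.1 ≠ w.1.2 ∧
        (1 - ε) * dist w.1.1 w.1.2 ≤ ∑ i ∈ w.2, |(w.1.1 - w.1.2) i|)
    (fun v w => Disjoint v.2 w.2) fun s _ => by
      set N₀ := s.biUnion Prod.snd with hN₀
      obtain ⟨x, hx, y, hy, hne, hsmall⟩ :=
        exists_ne_sum_abs_sub_lt hM hbdd N₀ (c := ε / 2 * δ) (by positivity)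
      have hd := hdisc x hx y hy hne
      have hpos : 0 < dist x y := hδ.trans_le hd
      obtain ⟨N₁, hN₁⟩ := exists_finset_lt_sum_abs (x - y) (c := (1 - ε / 2) * dist x y) (by
        rw [← dist_eq_norm]; nlinarith)
      refine ⟨((x, y), N₁ \ N₀), ⟨hx, hy, hne, ?_⟩, fun v hv => ?_⟩
      · have h1 : ∑ i ∈ N₁, |(x - y) i| ≤
            ∑ i ∈ N₁ \ N₀, |(x - y) i| + ∑ i ∈ N₀, |(x - y) i| := by
          rw [← Finset.sum_union Finset.sdiff_disjoint]
          refine Finset.sum_le_sum_of_subset_of_nonneg ?_ fun i _ _ => abs_nonneg _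
          rw [Finset.sdiff_union_self_eq_union]
          exact Finset.subset_union_left
        have h2 : ε / 2 * δ ≤ ε / 2 * dist x y := mul_le_mul_of_nonneg_left hd (by positivity)
        change (1 - ε) * dist x y ≤ ∑ i ∈ N₁ \ N₀, |(x - y) i|
        linarith
      · exact Finset.disjoint_sdiff.mono_left (Finset.subset_biUnion_of_mem Prod.snd hv)
  exact ⟨fun k => (w k).1.1, fun k => (w k).1.2, fun k => (w k).2, hw,
    (pairwise_disjoint_on _).2 hr⟩

/-- Erasing a block of coordinates from the argument of `F` leaves room, by additivity of the norm
of `ℓ₁`, for a functional of norm one that depends only on this block. The functions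
`F - F ∘ eraseCoords (N k)` are summable uniformly on the bounded set `M`, which on a uniformly
discrete set is enough for the domination of their increments. -/
theorem hasFlatPerturbations_of_isBounded_of_discrete {M : Set (lp (fun _ : ℕ => ℝ) 1)}
    (hM : M.Infinite) (hbdd : Bornology.IsBounded M) {δ : ℝ} (hδ : 0 < δ)
    (hdisc : ∀ x ∈ M, ∀ y ∈ M, x ≠ y → δ ≤ dist x y) {ε : ℝ} (hε : 0 < ε) :
    HasFlatPerturbations M ε := by
  obtain ⟨x, y, N, hxy, hN⟩ := exists_pairs_with_disjoint_blocks hM hbdd hδ hdisc hε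
  obtain ⟨R, hR0, hR⟩ := hbdd.exists_pos_norm_le
  set g : ℕ → lp (fun _ : ℕ => ℝ) 1 → ℝ :=
    fun k u => ∑ i ∈ N k, (SignType.sign ((x k - y k) i) : ℝ) * u i with hg
  have hgsub : ∀ k u v, g k u - g k v =
      ∑ i ∈ N k, (SignType.sign ((x k - y k) i) : ℝ) * (u - v) i := fun k u v => by
    simp only [hg, ← Finset.sum_sub_distrib, ← mul_sub, lp.coeFn_sub, Pi.sub_apply]
  have hgle : ∀ k u v, |g k u - g k v| ≤ ∑ i ∈ N k, |(u - v) i| := fun k u v => by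
    rw [hgsub]
    refine (Finset.abs_sum_le_sum_abs _ _).trans (Finset.sum_le_sum fun i _ => ?_)
    rw [abs_mul]
    refine mul_le_of_le_one_left (abs_nonneg _) ?_
    rcases lt_trichotomy ((x k - y k) i) 0 with h | h | h <;> simp only [h, sign_neg, sign_pos,
      sign_zero] <;> simp
  refine ⟨1 + 2 * R / δ, g, fun k F u => F (eraseCoords (N k) u), by positivity, fun k => ?_,
    fun s u _ v _ => ?_, fun F hF => ⟨fun k u _ v _ => ?_, fun s u hu v hv => ?_⟩⟩
  · obtain ⟨hx, hy, hne, hle⟩ := hxy k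
    refine ⟨x k, hx, y k, hy, hne, hle.trans (le_trans (le_of_eq ?_) (le_abs_self _))⟩
    rw [hgsub]
    exact Finset.sum_congr rfl fun i _ => (sign_mul_self _).symm
  · have h1 := (Finset.sum_le_sum fun k (_ : k ∈ s) => hgle k u v).trans
      (sum_sum_abs_le_norm hN s (u - v))
    rw [← dist_eq_norm] at h1
    refine h1.trans (le_mul_of_one_le_left dist_nonneg ?_)
    have : 0 ≤ 2 * R / δ := by positivity
    linarith
  · have h1 : |F (eraseCoords (N k) u) - F (eraseCoords (N k) v)| ≤
        ‖u - v‖ - ∑ i ∈ N k, |(u - v) i| := by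
      rw [← norm_eraseCoords, eraseCoords_sub, ← dist_eq_norm]
      simpa [Real.dist_eq] using hF.dist_le_mul (eraseCoords (N k) u) (eraseCoords (N k) v)
    rw [← dist_eq_norm] at h1
    have := hgle k u v
    nlinarith [dist_nonneg (x := u) (y := v)]
  · have hFe : ∀ w ∈ M, ∑ k ∈ s, |F w - F (eraseCoords (N k) w)| ≤ R := fun w hw => by
      refine le_trans (Finset.sum_le_sum fun k _ => ?_)
        ((sum_sum_abs_le_norm hN s w).trans (hR w hw))
      rw [← norm_sub_eraseCoords, ← dist_eq_norm]
      simpa [Real.dist_eq] using hF.dist_le_mul w (eraseCoords (N k) w)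
    rcases eq_or_ne u v with rfl | hne
    · simp
    · have h1 : ∑ k ∈ s, |(F u - F (eraseCoords (N k) u)) - (F v - F (eraseCoords (N k) v))| ≤
          2 * R := by
        refine (Finset.sum_le_sum fun k _ => abs_sub _ _).trans ?_
        rw [Finset.sum_add_distrib]
        linarith [hFe u hu, hFe v hv]
      have h2 : 2 * R ≤ 2 * R / δ * dist u v := by
        rw [div_mul_eq_mul_div, le_div_iff₀ hδ]
        exact mul_le_mul_of_nonneg_left (hdisc u hu v hv hne) (by positivity)
      linarith [dist_nonneg (x := u) (y := v)]

/-! ### The symmetric strong diameter two property -/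

theorem mainTheorem1 (M : Set (lp (fun _ : ℕ => ℝ) 1)) (hM : M.Infinite) (o : M) :
    HasSSD2P (LipZero M o) := by
  refine hasSSD2P_of_hasFlatPerturbations (fun ε hε => ?_) o
  by_cases hbdd : Bornology.IsBounded M
  · by_cases hdisc : ∃ δ > 0, ∀ x ∈ M, ∀ y ∈ M, x ≠ y → δ ≤ dist x y
    · obtain ⟨δ, hδ, hdisc⟩ := hdisc
      exact hasFlatPerturbations_of_isBounded_of_discrete hM hbdd hδ hdisc hε
    · push Not at hdisc
      refine hasFlatPerturbations_of_hasDisjointAnnuli (fun K hK => ?_) hε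
      rcases exists_accumulation_or_separated_close_pairs fun δ hδ => by
        obtain ⟨x, hx, y, hy, hne, hlt⟩ := hdisc δ hδ
        exact ⟨x, hx, y, hy, dist_pos.2 hne, hlt⟩ with ⟨p, hp⟩ | ⟨η, hη, H⟩
      · exact hasDisjointAnnuli_of_accumulation hp hK
      · exact hasDisjointAnnuli_of_separated_close_pairs hη H hK
  · exact hasFlatPerturbations_of_hasDisjointAnnuli
      (fun K hK => hasDisjointAnnuli_of_not_isBounded hbdd hK) hε
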